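/- All graphs are finite and simple. A matching of a graph is maximal if no other matching properly contains it, and a graph is equimatchable if all its maximal matchings have the same number of edges. For a vertex $v$ of $G$, $G-v$ is the subgraph of $G$ induced by $V(G)\setminus\{v\}$; for an edge $e$, $G\setminus e$ is the graph $(V(G),E(G)\setminus\{e\})$. A graph $G$ is an ESE-graph (edge-stable equimatchable) if $G$ is equimatchable and $G\setminus e$ is equimatchable for every $e\in E(G)$. An odd clique is a complete graph $K_{2r+1}$, $r\ge 0$. Let $G$ be a connected equimatchable graph. Then $G-v$ and $G\setminus e$ are equimatchable for all $v\in V(G)$ and all $e\in E(G)$ if and only if $G$ is an odd clique or a bipartite ESE-graph. -/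

import Mathlib

namespace SimpleGraph

/-- `M` is a maximal matching of `G`: a matching that no other matching properly contains. -/
def IsMaximalMatching {V : Type*} (G : SimpleGraph V) (M : G.Subgraph) : Prop :=
  Maximal (fun N : G.Subgraph => N.IsMatching) M

/-- All maximal matchings of `G` have the same number of edges. -/
def IsEquimatchable {V : Type*} (G : SimpleGraph V) : Prop :=
  ∀ M N : G.Subgraph, G.IsMaximalMatching M → G.IsMaximalMatching N →
    M.edgeSet.ncard = N.edgeSet.ncard

/-- `G - v`, the subgraph induced on all vertices other than `v`. -/
def removeVertex {V : Type*} (G : SimpleGraph V) (v : V) : SimpleGraph ({v}ᶜ : Set V) :=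
  G.induce ({v}ᶜ : Set V)

/-- `G ∖ e`, the graph on the same vertices with the edge `e` removed. -/
def removeEdge {V : Type*} (G : SimpleGraph V) (e : Sym2 V) : SimpleGraph V :=
  G.deleteEdges {e}

/-- Edge-stable equimatchable graphs (ESE-graphs). -/
def IsESE {V : Type*} (G : SimpleGraph V) : Prop :=
  G.IsEquimatchable ∧ ∀ e ∈ G.edgeSet, (G.removeEdge e).IsEquimatchable

/-- `G` is a complete graph on an odd number of vertices. -/
def IsOddClique {V : Type*} (G : SimpleGraph V) : Prop :=
  G = ⊤ ∧ Odd (Nat.card V)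

end SimpleGraph

namespace SimpleGraph

/-! A matching is represented by the set it covers; it is maximal exactly when that set is a vertex
cover, and equimatchability says that all such covers have equal size.

The argument turns on the set D of vertices missed by some maximal matching (`missable`). If G is
stable under vertex deletion, an exchange shows that D contains every vertex reached by two steps
from a vertex of D (`mem_missable_of_adj_adj`). By connectedness there are three cases. If D is
empty, edge stability makes every edge meet one fixed vertex. If D contains an edge, D is
everything, and the absence of augmenting paths makes G an odd clique. Otherwise D is one side of a
bipartition.

Conversely, in an odd clique with an edge deleted or a vertex isolated, any three vertices still
span an edge, so by parity a maximal matching misses exactly one vertex. For a bipartite ESE-graph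
the point is that D is independent (`missable_independent_of_isBipartite`); this controls how
maximal matchings of G - v extend to G. -/

variable {V : Type*} {G : SimpleGraph V}

/-! ### Matchings through the vertex sets they cover -/

/-- `G.Matchable S` says that `S` is the set of vertices covered by some finite matching of `G`. -/
inductive Matchable (G : SimpleGraph V) : Set V → Prop
  | empty : Matchable G ∅
  | addEdge {S : Set V} {a b : V} : Matchable G S → G.Adj a b → a ∉ S → b ∉ S →
      Matchable G (insert a (insert b S))

/-- Every edge of `G` has an endpoint in `S`. -/
def IsVertexCoverSet (G : SimpleGraph V) (S : Set V) : Prop :=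
  ∀ a b, G.Adj a b → a ∈ S ∨ b ∈ S

/-- Equimatchability in terms of the vertex sets covered by maximal matchings. -/
def EquiCovered (G : SimpleGraph V) : Prop :=
  ∀ S T : Set V, G.Matchable S → G.IsVertexCoverSet S → G.Matchable T → G.IsVertexCoverSet T →
    S.ncard = T.ncard

theorem Matchable.pair {a b : V} (h : G.Adj a b) : G.Matchable {a, b} := by
  have := Matchable.addEdge Matchable.empty h (by simp) (by simp)
  simpa using this

theorem Matchable.mono {H : SimpleGraph V} (hGH : G ≤ H) {S : Set V} (hS : G.Matchable S) :
    H.Matchable S := by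
  induction hS with
  | empty => exact .empty
  | addEdge _ hab ha hb ih => exact .addEdge ih (hGH hab) ha hb

theorem Matchable.union {S T : Set V} (hS : G.Matchable S) (hT : G.Matchable T)
    (hd : Disjoint S T) : G.Matchable (S ∪ T) := by
  induction hS with
  | empty => simpa using hT
  | addEdge _ hab ha hb ih =>
    simp only [Set.disjoint_insert_left] at hd
    simp only [Set.insert_union]
    exact .addEdge (ih hd.2.2) hab (by simp [ha, hd.1]) (by simp [hb, hd.2.1])

theorem Matchable.finite {S : Set V} (hS : G.Matchable S) : S.Finite := by
  induction hS with
  | empty => exact Set.finite_empty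
  | addEdge _ _ _ _ ih => exact (ih.insert _).insert _

theorem Matchable.ncard_insert_pair {S : Set V} (hS : G.Matchable S) {a b : V}
    (hab : G.Adj a b) (ha : a ∉ S) (hb : b ∉ S) :
    (insert a (insert b S)).ncard = S.ncard + 2 := by
  have := hS.finite
  rw [Set.ncard_insert_of_notMem (by simp [hab.ne, ha]) (this.insert _),
    Set.ncard_insert_of_notMem hb this]

theorem Matchable.even_ncard {S : Set V} (hS : G.Matchable S) : Even S.ncard := by
  induction hS with
  | empty => simp
  | addEdge h hab ha hb ih =>
    rw [h.ncard_insert_pair hab ha hb]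
    exact ih.add even_two

theorem Matchable.exists_adj {S : Set V} (hS : G.Matchable S) {v : V} (hv : v ∈ S) :
    ∃ w ∈ S, G.Adj v w := by
  induction hS with
  | empty => simp at hv
  | @addEdge S a b _ hab _ _ ih =>
    rcases hv with rfl | rfl | hv
    · exact ⟨b, by simp, hab⟩
    · exact ⟨a, by simp, hab.symm⟩
    · obtain ⟨w, hw, h⟩ := ih hv
      exact ⟨w, by simp [hw], h⟩

/-- Peel off matched pairs one at a time. Allowing any union of matched pairs, not only `M.verts`,
is what lets edges of `M` be exchanged later. -/
theorem Subgraph.IsMatching.matchable_of_closed {M : G.Subgraph} (hM : M.IsMatching) {T : Set V}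
    (hfin : T.Finite) (hT : T ⊆ M.verts) (hcl : ∀ a b, M.Adj a b → a ∈ T → b ∈ T) :
    G.Matchable T := by
  induction hn : T.ncard using Nat.strong_induction_on generalizing T with
  | _ n ih =>
  rcases T.eq_empty_or_nonempty with rfl | ⟨a, ha⟩
  · exact .empty
  obtain ⟨b, hab, -⟩ := hM (hT ha)
  have hb := hcl a b hab ha
  have hlt : (T \ {a, b}).ncard < T.ncard :=
    Set.ncard_lt_ncard ⟨Set.sdiff_subset, fun h => (h ha).2 (by simp)⟩ hfin
  have key := ih _ (hn ▸ hlt) (hfin.subset Set.sdiff_subset) (Set.sdiff_subset.trans hT) (by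
    rintro p q hpq ⟨hp, hp'⟩
    refine ⟨hcl p q hpq hp, ?_⟩
    rintro (rfl | rfl)
    · exact hp' (.inr (hM.eq_of_adj_left hpq.symm hab))
    · exact hp' (.inl (hM.eq_of_adj_right hpq hab))) rfl
  have := key.addEdge hab.adj_sub (by simp) (by simp)
  convert this using 1
  ext x
  by_cases hxa : x = a
  · simp [hxa, ha]
  by_cases hxb : x = b
  · simp [hxb, hb]
  simp [hxa, hxb]

theorem Subgraph.IsMatching.matchable [Finite V] {M : G.Subgraph} (hM : M.IsMatching) :
    G.Matchable M.verts :=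
  hM.matchable_of_closed (Set.toFinite _) le_rfl fun _ _ h _ => h.snd_mem

theorem Matchable.exists_isMatching {S : Set V} (hS : G.Matchable S) :
    ∃ M : G.Subgraph, M.IsMatching ∧ M.verts = S := by
  induction hS with
  | empty => exact ⟨⊥, fun v hv => by simp at hv, rfl⟩
  | @addEdge S a b _ hab ha hb ih =>
    obtain ⟨M, hM, rfl⟩ := ih
    refine ⟨G.subgraphOfAdj hab ⊔ M, (Subgraph.IsMatching.subgraphOfAdj hab).sup hM ?_, ?_⟩
    · rw [(Subgraph.IsMatching.subgraphOfAdj hab).support_eq_verts, hM.support_eq_verts]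
      simp [ha, hb]
    · ext x; simp [or_assoc]

theorem isMaximalMatching_iff {M : G.Subgraph} :
    G.IsMaximalMatching M ↔ M.IsMatching ∧ G.IsVertexCoverSet M.verts := by
  constructor
  · intro h
    refine ⟨h.prop, fun a b hab => ?_⟩
    by_contra! hcon
    have h1 : (M ⊔ G.subgraphOfAdj hab).IsMatching := by
      refine h.prop.sup (Subgraph.IsMatching.subgraphOfAdj hab) ?_
      rw [(Subgraph.IsMatching.subgraphOfAdj hab).support_eq_verts, h.prop.support_eq_verts]
      simp [hcon.1, hcon.2]
    exact hcon.1 ((h.le_of_ge h1 le_sup_left).1 (by simp))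
  · rintro ⟨hM, hc⟩
    refine ⟨hM, fun N hN hMN => ?_⟩
    have hv : ∀ p ∈ N.verts, p ∈ M.verts := by
      intro p hp
      obtain ⟨q, hpq, -⟩ := hN hp
      rcases hc p q hpq.adj_sub with h | h
      · exact h
      · obtain ⟨r, hqr, -⟩ := hM h
        rw [hN.eq_of_adj_left hpq.symm (hMN.2 hqr)]
        exact hqr.snd_mem
    refine ⟨hv, fun p q hpq => ?_⟩
    obtain ⟨r, hpr, -⟩ := hM (hv p hpq.fst_mem)
    rwa [hN.eq_of_adj_left hpq (hMN.2 hpr)]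

theorem Subgraph.IsMatching.two_mul_ncard_edgeSet [Finite V] {M : G.Subgraph}
    (hM : M.IsMatching) : 2 * M.edgeSet.ncard = M.verts.ncard := by
  classical
  have := Fintype.ofFinite V
  have h := M.spanningCoe.sum_degrees_support_eq_twice_card_edges
  have hs : M.spanningCoe.support = M.verts := hM.support_eq_verts
  rw [Finset.sum_congr rfl (g := fun _ => 1), Finset.sum_const, smul_eq_mul, mul_one] at h
  · rw [Set.ncard_eq_toFinset_card' M.verts, ← Subgraph.edgeSet_spanningCoe,
      Set.ncard_eq_toFinset_card']
    simp only [hs] at h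
    simpa [edgeFinset] using h.symm
  · intro v hv
    rw [Set.mem_toFinset, hs] at hv
    rw [Subgraph.degree_spanningCoe]
    exact Subgraph.isMatching_iff_forall_degree.mp hM v hv

theorem isEquimatchable_iff_equiCovered [Finite V] : G.IsEquimatchable ↔ G.EquiCovered := by
  constructor
  · intro h S T hS hS' hT hT'
    obtain ⟨M, hM, rfl⟩ := hS.exists_isMatching
    obtain ⟨N, hN, rfl⟩ := hT.exists_isMatching
    rw [← hM.two_mul_ncard_edgeSet, ← hN.two_mul_ncard_edgeSet,
      h M N (isMaximalMatching_iff.2 ⟨hM, hS'⟩) (isMaximalMatching_iff.2 ⟨hN, hT'⟩)]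
  · intro h M N hM hN
    rw [isMaximalMatching_iff] at hM hN
    have := h _ _ hM.1.matchable hM.2 hN.1.matchable hN.2
    rw [← hM.1.two_mul_ncard_edgeSet, ← hN.1.two_mul_ncard_edgeSet] at this
    omega

/-! ### Vertex deletion without changing the vertex type -/

/-- `G` with all edges at `v` removed. -/
def isolate (G : SimpleGraph V) (v : V) : SimpleGraph V where
  Adj a b := G.Adj a b ∧ a ≠ v ∧ b ≠ v
  symm := ⟨fun _ _ h => ⟨h.1.symm, h.2.2, h.2.1⟩⟩
  loopless := ⟨fun _ h => h.1.ne rfl⟩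

theorem matchable_isolate_iff {v : V} {S : Set V} :
    (G.isolate v).Matchable S ↔ G.Matchable S ∧ v ∉ S := by
  constructor
  · intro h
    induction h with
    | empty => exact ⟨.empty, by simp⟩
    | addEdge _ hab ha hb ih => exact ⟨.addEdge ih.1 hab.1 ha hb, by
        simp [ih.2, hab.2.1.symm, hab.2.2.symm]⟩
  · rintro ⟨h, hv⟩
    induction h with
    | empty => exact .empty
    | addEdge _ hab ha hb ih =>
      simp only [Set.mem_insert_iff, not_or] at hv
      exact .addEdge (ih hv.2.2) ⟨hab, Ne.symm hv.1, Ne.symm hv.2.1⟩ ha hb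

theorem Matchable.image_val {v : V} {S : Set ({v}ᶜ : Set V)} (hS : (G.removeVertex v).Matchable S) :
    (G.isolate v).Matchable (Subtype.val '' S) := by
  induction hS with
  | empty => simpa using Matchable.empty
  | @addEdge S a b _ hab ha hb ih =>
    rw [Set.image_insert_eq, Set.image_insert_eq]
    exact .addEdge ih ⟨hab, a.2, b.2⟩ (by simpa using fun _ => ha) (by simpa using fun _ => hb)

theorem Matchable.exists_image_val {v : V} {S : Set V} (hS : (G.isolate v).Matchable S) :
    ∃ T : Set ({v}ᶜ : Set V), (G.removeVertex v).Matchable T ∧ Subtype.val '' T = S := by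
  induction hS with
  | empty => exact ⟨∅, .empty, by simp⟩
  | @addEdge S a b _ hab ha hb ih =>
    obtain ⟨T, hT, rfl⟩ := ih
    refine ⟨insert ⟨a, hab.2.1⟩ (insert ⟨b, hab.2.2⟩ T), .addEdge hT
      (show (G.removeVertex v).Adj ⟨a, hab.2.1⟩ ⟨b, hab.2.2⟩ from hab.1) ?_ ?_, ?_⟩
    · exact fun h => ha ⟨_, h, rfl⟩
    · exact fun h => hb ⟨_, h, rfl⟩
    · simp [Set.image_insert_eq]

theorem isVertexCoverSet_isolate_image_iff {v : V} {S : Set ({v}ᶜ : Set V)} :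
    (G.isolate v).IsVertexCoverSet (Subtype.val '' S) ↔ (G.removeVertex v).IsVertexCoverSet S := by
  constructor
  · intro h a b hab
    have := h a b ⟨hab, a.2, b.2⟩
    rwa [Subtype.val_injective.mem_set_image, Subtype.val_injective.mem_set_image] at this
  · intro h a b hab
    exact (h ⟨a, hab.2.1⟩ ⟨b, hab.2.2⟩ hab.1).imp (fun h => ⟨_, h, rfl⟩) (fun h => ⟨_, h, rfl⟩)

theorem removeVertex_isEquimatchable_iff [Finite V] {v : V} :
    (G.removeVertex v).IsEquimatchable ↔ (G.isolate v).EquiCovered := by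
  rw [isEquimatchable_iff_equiCovered]
  constructor
  · intro h S T hS hS' hT hT'
    obtain ⟨S', hS₁, rfl⟩ := hS.exists_image_val
    obtain ⟨T', hT₁, rfl⟩ := hT.exists_image_val
    rw [isVertexCoverSet_isolate_image_iff] at hS' hT'
    rw [Set.ncard_image_of_injective _ Subtype.val_injective,
      Set.ncard_image_of_injective _ Subtype.val_injective]
    exact h S' T' hS₁ hS' hT₁ hT'
  · intro h S T hS hS' hT hT'
    have := h _ _ hS.image_val (isVertexCoverSet_isolate_image_iff.2 hS') hT.image_val
      (isVertexCoverSet_isolate_image_iff.2 hT')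
    rwa [Set.ncard_image_of_injective _ Subtype.val_injective,
      Set.ncard_image_of_injective _ Subtype.val_injective] at this

/-! ### Edge deletion, extension and size comparison -/

theorem removeEdge_adj {a b p q : V} :
    (G.removeEdge s(a, b)).Adj p q ↔ G.Adj p q ∧ s(p, q) ≠ s(a, b) := by
  simp [removeEdge]

theorem removeEdge_le (e : Sym2 V) : G.removeEdge e ≤ G := G.deleteEdges_le {e}

theorem Matchable.removeEdge {a b : V} {S : Set V} (hS : G.Matchable S) (ha : a ∉ S) :
    (G.removeEdge s(a, b)).Matchable S := by
  induction hS with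
  | empty => exact .empty
  | addEdge _ hpq hp hq ih =>
    simp only [Set.mem_insert_iff, not_or] at ha
    exact .addEdge (ih ha.2.2) (removeEdge_adj.2 ⟨hpq, by simp; grind⟩) hp hq

theorem Matchable.exists_extension [Finite V] {S : Set V} (hS : G.Matchable S) :
    ∃ R, G.Matchable R ∧ Disjoint S R ∧ G.Matchable (S ∪ R) ∧ G.IsVertexCoverSet (S ∪ R) := by
  obtain ⟨R, hR⟩ := (Set.toFinite {R | G.Matchable R ∧ Disjoint S R}).exists_maximal
    ⟨∅, .empty, by simp⟩
  refine ⟨R, hR.prop.1, hR.prop.2, hS.union hR.prop.1 hR.prop.2, fun a b hab => ?_⟩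
  by_contra! hcon
  simp only [Set.mem_union, not_or] at hcon
  have := hR.le_of_ge (y := insert a (insert b R))
    ⟨hR.prop.1.addEdge hab hcon.1.2 hcon.2.2, by simp [hcon, hR.prop.2]⟩
    ((Set.subset_insert _ _).trans (Set.subset_insert _ _))
  exact hcon.1.2 (this (by simp))

theorem EquiCovered.ncard_le [Finite V] (hG : G.EquiCovered) {S T : Set V} (hT : G.Matchable T)
    (hS : G.Matchable S) (hS' : G.IsVertexCoverSet S) : T.ncard ≤ S.ncard := by
  obtain ⟨R, -, -, h1, h2⟩ := hT.exists_extension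
  rw [← hG _ _ h1 h2 hS hS']
  exact Set.ncard_le_ncard Set.subset_union_left

theorem EquiCovered.not_matchable_of_ssubset [Finite V] (hG : G.EquiCovered) {S T : Set V}
    (hS : G.Matchable S) (hS' : G.IsVertexCoverSet S) (hST : S ⊂ T) : ¬ G.Matchable T := fun hT =>
  (Set.ncard_lt_ncard hST).not_ge (hG.ncard_le hT hS hS')

theorem EquiCovered.isVertexCoverSet_of_ncard_le [Finite V] (hG : G.EquiCovered) {S T : Set V}
    (hS : G.Matchable S) (hS' : G.IsVertexCoverSet S) (hT : G.Matchable T)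
    (h : S.ncard ≤ T.ncard) : G.IsVertexCoverSet T := by
  intro a b hab
  by_contra! hcon
  have h1 := hG.ncard_le (hT.addEdge hab hcon.1 hcon.2) hS hS'
  rw [hT.ncard_insert_pair hab hcon.1 hcon.2] at h1
  omega

theorem Connected.eq_univ_of_closed (hG : G.Connected) {S : Set V} {x : V} (hx : x ∈ S)
    (h : ∀ p q, p ∈ S → G.Adj p q → q ∈ S) (y : V) : y ∈ S := by
  obtain ⟨w⟩ := hG.preconnected x y
  induction w with
  | nil => exact hx
  | cons hadj _ ih => exact ih (h _ _ hx hadj)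

theorem Subgraph.IsMatching.matchable_sdiff_pair [Finite V] {M : G.Subgraph} (hM : M.IsMatching)
    {T : Set V} (hT : T ⊆ M.verts) (hcl : ∀ a b, M.Adj a b → a ∈ T → b ∈ T)
    {v w : V} (h : M.Adj v w) :
    T \ {v, w} ⊆ M.verts ∧ ∀ a b, M.Adj a b → a ∈ T \ {v, w} → b ∈ T \ {v, w} := by
  refine ⟨Set.sdiff_subset.trans hT, ?_⟩
  rintro a b hab ⟨ha, ha'⟩
  refine ⟨hcl a b hab ha, ?_⟩
  rintro (rfl | rfl)
  · exact ha' (.inr (hM.eq_of_adj_left hab.symm h))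
  · exact ha' (.inl (hM.eq_of_adj_right hab h))

/-! ### Augmenting paths of lengths three and five -/

/-- A pair of matched vertices joined to distinct unmatched vertices yields a larger matching. -/
theorem EquiCovered.eq_of_adj_unmatched [Finite V] (hG : G.EquiCovered) {M : G.Subgraph}
    (hM : M.IsMatching) (hc : G.IsVertexCoverSet M.verts) {p q x y : V} (hpq : M.Adj p q)
    (hx : x ∉ M.verts) (hy : y ∉ M.verts) (hpx : G.Adj p x) (hqy : G.Adj q y) : x = y := by
  by_contra hxy
  have hp := hpq.fst_mem
  have hq := hpq.snd_mem
  have hne := hpq.adj_sub.ne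
  obtain ⟨h1, h2⟩ := hM.matchable_sdiff_pair le_rfl (fun _ _ h _ => h.snd_mem) hpq
  have h3 := hM.matchable_of_closed (Set.toFinite _) h1 h2
  have h4 := (h3.addEdge hpx (by simp) (by simp [hx])).addEdge hqy
    (by simp [hne.symm]; grind) (by simp [hy]; grind)
  refine hG.not_matchable_of_ssubset hM.matchable hc ⟨fun z hz => ?_, fun h => hx (h ?_)⟩ h4
  · simp [hz]; tauto
  · simp

/-- Two matched edges joined by an edge, whose other ends see distinct unmatched vertices,
yield a larger matching. -/
theorem EquiCovered.eq_of_adj_unmatched_of_adj [Finite V] (hG : G.EquiCovered) {M : G.Subgraph}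
    (hM : M.IsMatching) (hc : G.IsVertexCoverSet M.verts) {p p' q q' x y : V}
    (hp : M.Adj p p') (hq : M.Adj q q') (hpq : G.Adj p q) (hqp : q ≠ p')
    (hx : x ∉ M.verts) (hy : y ∉ M.verts) (hpx : G.Adj p' x) (hqy : G.Adj q' y) : x = y := by
  by_contra hxy
  have m1 := hp.fst_mem
  have m2 := hp.snd_mem
  have m3 := hq.fst_mem
  have m4 := hq.snd_mem
  have n1 := hp.adj_sub.ne
  have n2 := hq.adj_sub.ne
  have n3 := hpq.ne
  have n4 : p ≠ q' := by rintro rfl; exact hqp (hM.eq_of_adj_left hq.symm hp)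
  have n5 : p' ≠ q' := by rintro rfl; exact n3 (hM.eq_of_adj_right hp hq)
  obtain ⟨h1, h2⟩ := hM.matchable_sdiff_pair le_rfl (fun _ _ h _ => h.snd_mem) hp
  obtain ⟨h1, h2⟩ := hM.matchable_sdiff_pair h1 h2 hq
  have h3 := hM.matchable_of_closed (Set.toFinite _) h1 h2
  have h4 := ((h3.addEdge hpq (by simp) (by simp)).addEdge hpx (by simp; grind)
    (by simp [hx]; grind)).addEdge hqy (by simp; grind) (by simp [hy]; grind)
  refine hG.not_matchable_of_ssubset hM.matchable hc ⟨fun z hz => ?_, fun h => hx (h ?_)⟩ h4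
  · simp [hz]; tauto
  · simp

/-! ### Missable vertices and the two stability conditions -/

/-- The vertices missed by some maximal matching. -/
def missable (G : SimpleGraph V) : Set V :=
  {v | ∃ S, G.Matchable S ∧ G.IsVertexCoverSet S ∧ v ∉ S}

theorem IsVertexCoverSet.isolate {S : Set V} (h : G.IsVertexCoverSet S) (v : V) :
    (G.isolate v).IsVertexCoverSet S := fun a b hab => h a b hab.1

/-- Extend `ab` to a maximal matching of G - d. It has the size of a maximal matching of G missing
`d`, so trading `ab` for `da` keeps that size, hence maximality in G, and frees `b`. -/
theorem EquiCovered.mem_missable_of_adj_adj [Finite V] (hG : G.EquiCovered) {d a b : V}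
    (hd' : (G.isolate d).EquiCovered) (hd : d ∈ G.missable) (hda : G.Adj d a) (hab : G.Adj a b)
    (hbd : b ≠ d) : b ∈ G.missable := by
  obtain ⟨S, hS, hS', hdS⟩ := hd
  obtain ⟨R, hR, hdis, h1, h2⟩ :=
    (Matchable.pair (G := G.isolate d) ⟨hab, hda.ne', hbd⟩).exists_extension
  have hcard := hd' _ _ h1 h2 (matchable_isolate_iff.2 ⟨hS, hdS⟩) (hS'.isolate d)
  rw [matchable_isolate_iff] at hR h1
  simp only [Set.disjoint_insert_left, Set.disjoint_singleton_left] at hdis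
  have h3 := hR.1.addEdge hda hR.2 hdis.1
  refine ⟨_, h3, hG.isVertexCoverSet_of_ncard_le hS hS' h3 ?_, ?_⟩
  · rw [hR.1.ncard_insert_pair hda hR.2 hdis.1, ← hcard, Set.insert_union, Set.singleton_union,
      hR.1.ncard_insert_pair hab hdis.1 hdis.2]
  · simp [hbd, hab.ne', hdis.2]

theorem isBipartite_of_set (D : Set V) (h : ∀ a b, G.Adj a b → (a ∈ D ↔ b ∉ D)) :
    G.IsBipartite := by
  classical
  refine ⟨Coloring.mk (fun v => if v ∈ D then 0 else 1) ?_⟩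
  intro a b hab
  have := h a b hab
  by_cases hb : b ∈ D <;> simp_all

/-- In an edge-stable equimatchable graph, a matched edge that is not an isolated edge sees an
unmatched vertex. -/
theorem EquiCovered.exists_adj_unmatched [Finite V] (hG : G.EquiCovered) {a b c : V}
    (he : (G.removeEdge s(a, b)).EquiCovered) (hab : G.Adj a b)
    (hc : (G.Adj a c ∧ c ≠ b) ∨ (G.Adj b c ∧ c ≠ a)) {R : Set V} (hR : G.Matchable R)
    (ha : a ∉ R) (hb : b ∉ R) (hcov : G.IsVertexCoverSet (insert a (insert b R))) :
    ∃ x, x ≠ a ∧ x ≠ b ∧ x ∉ R ∧ (G.Adj a x ∨ G.Adj b x) := by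
  by_contra! hcon
  -- With no unmatched neighbour of `a` or `b`, the only edge that `R` leaves uncovered is `ab`
  -- itself.
  have hRc : (G.removeEdge s(a, b)).IsVertexCoverSet R := by
    intro p q hpq
    rw [removeEdge_adj] at hpq
    have h1 := hcov p q hpq.1
    have h2 := hcon p
    have h3 := hcon q
    have h4 := hpq.1.ne
    have h5 := hpq.1.symm
    have h6 := hpq.1
    have h7 := hpq.2
    simp only [Set.mem_insert_iff, ne_eq, Sym2.eq_iff] at h1 h7
    by_contra! h8
    grind
  -- A maximal matching of the edge-deleted graph that uses another edge at `a` or `b` is also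
  -- maximal in G, so it covers two vertices more than `R`.
  obtain ⟨T, hT, hTc, hT'⟩ : ∃ T, (G.removeEdge s(a, b)).Matchable T ∧
      (G.removeEdge s(a, b)).IsVertexCoverSet T ∧ (a ∈ T ∨ b ∈ T) := by
    rcases hc with ⟨h, hne⟩ | ⟨h, hne⟩
    · have : (G.removeEdge s(a, b)).Adj a c := removeEdge_adj.2 ⟨h, by
        simp [hne, hab.ne]⟩
      obtain ⟨Q, -, -, h1, h2⟩ := (Matchable.pair this).exists_extension
      exact ⟨_, h1, h2, by simp⟩
    · have : (G.removeEdge s(a, b)).Adj b c := removeEdge_adj.2 ⟨h, by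
        simp [hne, hab.ne']⟩
      obtain ⟨Q, -, -, h1, h2⟩ := (Matchable.pair this).exists_extension
      exact ⟨_, h1, h2, by simp⟩
  have hTG : G.IsVertexCoverSet T := by
    intro p q hpq
    by_cases h : s(p, q) = s(a, b)
    · simp only [Sym2.eq_iff] at h; grind
    · exact hTc p q (removeEdge_adj.2 ⟨hpq, h⟩)
  have h1 := he _ _ hT hTc (hR.removeEdge ha) hRc
  have h2 := hG _ _ (hT.mono (removeEdge_le _)) hTG (hR.addEdge hab ha hb) hcov
  rw [hR.ncard_insert_pair hab ha hb] at h2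
  omega

theorem Connected.exists_adj_of_ne (hG : G.Connected) {a b z : V} (hza : z ≠ a) (hzb : z ≠ b) :
    ∃ c, (G.Adj a c ∧ c ≠ b) ∨ (G.Adj b c ∧ c ≠ a) := by
  by_contra! h
  have := hG.eq_univ_of_closed (S := {a, b}) (x := a) (by simp) (by
    rintro p q (rfl | rfl) hpq
    · exact .inr ((h q).1 hpq)
    · exact .inl ((h q).2 hpq)) z
  simp [hza, hzb] at this

/-- Otherwise `M` without `vw` is maximal in G - v, yet smaller than a maximal matching of G that
misses `v`. -/
theorem Subgraph.IsMatching.exists_unmatched_adj [Finite V] (hG : G.EquiCovered)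
    {M : G.Subgraph} (hM : M.IsMatching) (hc : G.IsVertexCoverSet M.verts) {v w : V}
    (hv : (G.isolate v).EquiCovered) (hv' : v ∈ G.missable) (hvw : M.Adj v w) :
    ∃ x ∉ M.verts, G.Adj w x := by
  by_contra! hcon
  obtain ⟨S, hS, hS', hvS⟩ := hv'
  obtain ⟨h1, h2⟩ := hM.matchable_sdiff_pair le_rfl (fun _ _ h _ => h.snd_mem) hvw
  have hT := hM.matchable_of_closed (Set.toFinite _) h1 h2
  have hTc : (G.isolate v).IsVertexCoverSet (M.verts \ {v, w}) := by
    rintro p q ⟨hpq, hp, hq⟩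
    have h3 := hc p q hpq
    have h4 := hcon p
    have h5 := hcon q
    have h6 := hpq.ne
    have h7 := hpq.symm
    simp only [Set.mem_sdiff, Set.mem_insert_iff, Set.mem_singleton_iff]
    grind
  have e1 := hv _ _ (matchable_isolate_iff.2 ⟨hT, by simp⟩) hTc
    (matchable_isolate_iff.2 ⟨hS, hvS⟩) (hS'.isolate v)
  have e2 := hG _ _ hS hS' hM.matchable hc
  have e3 : (M.verts \ {v, w}).ncard < M.verts.ncard :=
    Set.ncard_lt_ncard ⟨Set.sdiff_subset, fun h => (h hvw.fst_mem).2 (by simp)⟩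
  omega

/-! ### From stability to odd cliques or bipartite graphs -/

theorem isOddClique_of_missable_eq_univ [Finite V] (hconn : G.Connected) (hG : G.EquiCovered)
    (hv : ∀ v, (G.isolate v).EquiCovered) (hD : ∀ v, v ∈ G.missable) : G.IsOddClique := by
  have key : ∀ x, ∃ S, G.Matchable S ∧ x ∉ S ∧ ∀ y, y = x ∨ (y ∈ S ∧ G.Adj y x) := by
    intro x
    obtain ⟨S, hS, hc, hx⟩ := hD x
    obtain ⟨M, hM, rfl⟩ := hS.exists_isMatching
    refine ⟨M.verts, hS, hx, ?_⟩
    have hatt : ∀ p q, M.Adj p q → ∃ y ∉ M.verts, G.Adj q y := fun p q hpq =>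
      hM.exists_unmatched_adj hG hc (hv p) (hD p) hpq
    have huniq : ∀ p q y z, M.Adj p q → y ∉ M.verts → z ∉ M.verts → G.Adj p y → G.Adj q z →
        y = z := fun p q y z h1 h2 h3 h4 h5 => hG.eq_of_adj_unmatched hM hc h1 h2 h3 h4 h5
    -- Both ends of each matched edge see unmatched vertices, necessarily the same one. The
    -- length-five path carries this common vertex `x` from one matched edge to an adjacent one, so
    -- `x` sees everything else.
    refine hconn.eq_univ_of_closed (S := {y | y = x ∨ (y ∈ M.verts ∧ G.Adj y x)}) (x := x)
      (by simp) ?_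
    rintro p q (rfl | ⟨hp, hpx⟩) hpq
    · exact .inr ⟨(hc _ _ hpq).resolve_left hx, hpq.symm⟩
    obtain ⟨p', hpp', -⟩ := hM hp
    obtain ⟨x', hx', hpx'⟩ := hatt _ _ hpp'
    obtain rfl := huniq _ _ _ _ hpp' hx hx' hpx hpx'
    by_cases hq : q ∈ M.verts
    · refine .inr ⟨hq, ?_⟩
      by_cases hqp : q = p'
      · exact hqp ▸ hpx'
      obtain ⟨q', hqq', -⟩ := hM hq
      obtain ⟨y, hy, hqy⟩ := hatt _ _ hqq'
      obtain ⟨z, hz, hqz⟩ := hatt _ _ hqq'.symm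
      obtain rfl := huniq _ _ _ _ hqq' hz hy hqz hqy
      rwa [hG.eq_of_adj_unmatched_of_adj hM hc hpp' hqq' hpq hqp hx hy hpx' hqy]
    · obtain ⟨z, hz, hpz⟩ := hatt _ _ hpp'
      exact .inl (huniq _ _ _ _ hpp' hq hx hpq hpx')
  refine ⟨?_, ?_⟩
  · ext a b
    rw [top_adj]
    refine ⟨fun h => h.ne, fun h => ?_⟩
    obtain ⟨S, -, -, hS⟩ := key b
    exact ((hS a).resolve_left h).2
  · obtain ⟨x⟩ := hconn.nonempty
    obtain ⟨S, hS, hx, hS'⟩ := key x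
    have : insert x S = Set.univ := by
      ext y
      have := hS' y
      simp only [Set.mem_insert_iff, Set.mem_univ, iff_true]
      tauto
    rw [← Set.ncard_univ, ← this, Set.ncard_insert_of_notMem hx]
    exact hS.even_ncard.add_one

/-- An edge avoiding `a` is not a whole component, so edge stability gives a vertex missed by a
maximal matching through it. Hence every edge meets `a`. -/
theorem isBipartite_of_missable_eq_empty [Finite V] (hconn : G.Connected) (hG : G.EquiCovered)
    (he : ∀ a b, G.Adj a b → (G.removeEdge s(a, b)).EquiCovered) (hD : ∀ v, v ∉ G.missable) :
    G.IsBipartite := by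
  obtain ⟨a⟩ := hconn.nonempty
  refine isBipartite_of_set {a} fun p q hpq => ?_
  by_contra hcon
  have hne : a ≠ p ∧ a ≠ q := by
    have := hpq.ne
    simp only [Set.mem_singleton_iff] at hcon
    grind
  obtain ⟨c, hc⟩ := hconn.exists_adj_of_ne hne.1 hne.2
  obtain ⟨R, hR, hdis, h1, h2⟩ := (Matchable.pair hpq).exists_extension
  simp only [Set.disjoint_insert_left, Set.disjoint_singleton_left] at hdis
  rw [Set.insert_union, Set.singleton_union] at h1 h2
  obtain ⟨x, hxp, hxq, hxR, -⟩ := hG.exists_adj_unmatched (he p q hpq) hpq hc hR hdis.1 hdis.2 h2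
  exact hD x ⟨_, h1, h2, by simp [hxp, hxq, hxR]⟩

theorem isOddClique_or_isBipartite [Finite V] (hconn : G.Connected) (hG : G.EquiCovered)
    (hv : ∀ v, (G.isolate v).EquiCovered)
    (he : ∀ a b, G.Adj a b → (G.removeEdge s(a, b)).EquiCovered) :
    G.IsOddClique ∨ G.IsBipartite := by
  by_cases hD : ∀ v, v ∉ G.missable
  · exact .inr (isBipartite_of_missable_eq_empty hconn hG he hD)
  push Not at hD
  obtain ⟨d, hd⟩ := hD
  have step : ∀ d a b, d ∈ G.missable → G.Adj d a → G.Adj a b → b ∈ G.missable := by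
    intro d a b hd hda hab
    by_cases hbd : b = d
    · exact hbd ▸ hd
    · exact hG.mem_missable_of_adj_adj (hv d) hd hda hab hbd
  by_cases hind : ∃ d₁ ∈ G.missable, ∃ d₂ ∈ G.missable, G.Adj d₁ d₂
  · left
    obtain ⟨d₁, h₁, d₂, h₂, h₁₂⟩ := hind
    refine isOddClique_of_missable_eq_univ hconn hG hv fun v => ?_
    refine (hconn.eq_univ_of_closed
      (S := {v | v ∈ G.missable ∧ ∃ u ∈ G.missable, G.Adj u v}) (x := d₁)
      ⟨h₁, d₂, h₂, h₁₂.symm⟩ ?_ v).1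
    rintro p q ⟨hp, u, hu, hup⟩ hpq
    exact ⟨step u p q hu hup hpq, p, hp, hpq⟩
  · right
    push Not at hind
    have hall := hconn.eq_univ_of_closed
      (S := {v | v ∈ G.missable ∨ ∃ u ∈ G.missable, G.Adj u v}) (x := d) (.inl hd) (by
        rintro p q (hp | ⟨u, hu, hup⟩) hpq
        · exact .inr ⟨p, hp, hpq⟩
        · exact .inl (step u p q hu hup hpq))
    refine isBipartite_of_set G.missable fun a b hab => ⟨fun ha hb => hind a ha b hb hab, ?_⟩
    intro hb
    obtain h | ⟨u, hu, hub⟩ := hall b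
    · exact absurd h hb
    · exact step u b a hu hub hab.symm

/-! ### Bipartite ESE-graphs are stable under vertex deletion -/

theorem Matchable.two_mul_ncard_inter [Finite V] {S : Set V} (hS : G.Matchable S)
    (c : G.Coloring (Fin 2)) (k : Fin 2) : 2 * (S ∩ {v | c v = k}).ncard = S.ncard := by
  induction hS with
  | empty => simp
  | @addEdge S a b h hab ha hb ih =>
    have hc := c.valid hab
    rw [h.ncard_insert_pair hab ha hb, ← ih]
    by_cases hk : c a = k
    · rw [Set.insert_inter_of_mem (by exact hk), Set.insert_inter_of_notMem
        (by simp; grind), Set.ncard_insert_of_notMem (by simp [ha])]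
      omega
    · rw [Set.insert_inter_of_notMem (by exact hk), Set.insert_inter_of_mem
        (by simp; omega), Set.ncard_insert_of_notMem (by simp [hb])]
      omega

/-- If `v` and `x` were adjacent, a maximal matching missing `x` would cover the whole colour class
of `v`, so one missing `v` would be strictly smaller. -/
theorem missable_independent_of_isBipartite [Finite V] (hconn : G.Connected) (hG : G.EquiCovered)
    (he : ∀ a b, G.Adj a b → (G.removeEdge s(a, b)).EquiCovered) (c : G.Coloring (Fin 2))
    {v x : V} (hv : v ∈ G.missable) (hx : x ∈ G.missable) : ¬ G.Adj v x := by
  intro hvx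
  obtain ⟨S, hS, hc, hxS⟩ := hx
  obtain ⟨M, hM, rfl⟩ := hS.exists_isMatching
  have hvalid : ∀ a b, G.Adj a b → c a ≠ c b := fun a b h => c.valid h
  have hatt : ∀ p q, M.Adj p q → ∃ u ∉ M.verts, G.Adj p u ∨ G.Adj q u := by
    intro p q hpq
    obtain ⟨z, hz⟩ := hconn.exists_adj_of_ne (z := x) (a := p) (b := q)
      (by rintro rfl; exact hxS hpq.fst_mem) (by rintro rfl; exact hxS hpq.snd_mem)
    obtain ⟨h1, h2⟩ := hM.matchable_sdiff_pair le_rfl (fun _ _ h _ => h.snd_mem) hpq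
    have hR := hM.matchable_of_closed (Set.toFinite _) h1 h2
    have heq : insert p (insert q (M.verts \ {p, q})) = M.verts := by
      have := hpq.fst_mem
      have := hpq.snd_mem
      ext y; simp; grind
    obtain ⟨y, hyp, hyq, hyR, hy⟩ := hG.exists_adj_unmatched (he p q hpq.adj_sub) hpq.adj_sub hz hR
      (by simp) (by simp) (heq.symm ▸ hc)
    exact ⟨y, fun h => hyR ⟨h, by simp [hyp, hyq]⟩, hy⟩
  have haug := fun {p q y z : V} => hG.eq_of_adj_unmatched (p := p) (q := q) (x := y) (y := z) hM hc
  have haug' := fun {p p' q q' y z : V} =>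
    hG.eq_of_adj_unmatched_of_adj (p := p) (p' := p') (q := q) (q' := q') (x := y) (y := z) hM hc
  -- Invariant along walks from `x`: a vertex of the other colour is matched and sees an unmatched
  -- vertex; a vertex of the colour of `x` is unmatched or has a partner seeing an unmatched vertex.
  have hall := hconn.eq_univ_of_closed (S := {p | (p ∉ M.verts ∧ c p = c x) ∨
      (c p ≠ c x ∧ ∃ u ∉ M.verts, G.Adj p u ∧ p ∈ M.verts) ∨
      (c p = c x ∧ ∃ r, M.Adj p r ∧ ∃ u ∉ M.verts, G.Adj r u)}) (x := x) (.inl ⟨hxS, rfl⟩) (by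
    rintro p q (⟨hp, hpc⟩ | ⟨hpc, u, hu, hpu, hp⟩ | ⟨hpc, r, hpr, u, hu, hru⟩) hpq
    · have hq := (hc p q hpq).resolve_left hp
      exact .inr (.inl ⟨fun h => hvalid _ _ hpq (hpc.trans h.symm), p, hp, hpq.symm, hq⟩)
    · have hqc : c q = c x := by
        have := hvalid _ _ hpq
        omega
      by_cases hq : q ∈ M.verts
      · obtain ⟨r, hqr, -⟩ := hM hq
        refine .inr (.inr ⟨hqc, r, hqr, ?_⟩)
        by_cases hqp : r = p
        · exact ⟨u, hu, hqp ▸ hpu⟩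
        by_contra! hcon
        obtain ⟨l, hpl, -⟩ := hM hp
        obtain ⟨u', hu', h⟩ := hatt _ _ hqr
        have hqu' : G.Adj q u' := h.resolve_right (hcon u' hu')
        have huu' : u ≠ u' := by
          rintro rfl
          have := hvalid _ _ hqu'
          have := hvalid _ _ hpu
          omega
        -- Otherwise replacing `p l` and `q r` by `p q` gives a smaller maximal matching.
        have hlr : G.Adj l r := by
          by_contra hlr
          have hl : ∀ y ∉ M.verts, ¬ G.Adj l y := by
            intro y hy hly
            have := haug hpl hu hy hpu hly
            subst this
            have := hvalid _ _ hpl.adj_sub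
            have := hvalid _ _ hpu
            have := hvalid _ _ hly
            omega
          have hne : p ≠ l := hpl.adj_sub.ne
          have hne' : q ≠ r := hqr.adj_sub.ne
          have hrl : r ≠ l := fun h => hpq.ne (hM.eq_of_adj_right hpl (h ▸ hqr))
          have hql : q ≠ l := fun h => hqp (hM.eq_of_adj_left hqr (h ▸ hpl.symm))
          obtain ⟨h1, h2⟩ := hM.matchable_sdiff_pair le_rfl (fun _ _ h _ => h.snd_mem) hpl
          obtain ⟨h1, h2⟩ := hM.matchable_sdiff_pair h1 h2 hqr
          have hT := (hM.matchable_of_closed (Set.toFinite _) h1 h2).addEdge hpq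
            (by simp) (by simp)
          have hsub : insert p (insert q ((M.verts \ {p, l}) \ {q, r})) ⊂ M.verts := by
            refine ⟨?_, fun h => ?_⟩
            · rintro y (rfl | rfl | hy)
              exacts [hp, hq, hy.1.1]
            · have := h hpl.snd_mem
              simp [hne.symm, hql.symm] at this
          have hmem : ∀ y, y ∉ insert p (insert q ((M.verts \ {p, l}) \ {q, r})) →
              y ∉ M.verts ∨ y = l ∨ y = r := by
            intro y
            simp only [Set.mem_insert_iff, Set.mem_sdiff, Set.mem_singleton_iff]
            tauto
          refine hG.not_matchable_of_ssubset hT ?_ hsub hS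
          intro y z hyz
          by_contra! h
          have h3 := hc y z hyz
          have h4 := hyz.ne
          have h5 := hyz.symm
          rcases hmem y h.1 with hy | rfl | rfl <;> rcases hmem z h.2 with hz | rfl | rfl
          · tauto
          · exact hl _ hy h5
          · exact hcon _ hy h5
          · exact hl _ hz hyz
          · exact h4 rfl
          · exact hlr hyz
          · exact hcon _ hz hyz
          · exact hlr h5
          · exact h4 rfl
        -- The augmenting path is `u p l r q u'`.
        exact huu' (haug' hpl.symm hqr.symm hlr (by exact hqp) hu hu' hpu hqu')
      · exact .inl ⟨hq, hqc⟩
    · have hqc : c q ≠ c x := by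
        have := hvalid _ _ hpq
        omega
      have hq : q ∈ M.verts := by
        by_contra hq
        have := haug hpr hq hu hpq hru
        subst this
        have := hvalid _ _ hpr.adj_sub
        have := hvalid _ _ hpq
        have := hvalid _ _ hru
        omega
      obtain ⟨l, hql, -⟩ := hM hq
      by_cases hqr : q = r
      · exact .inr (.inl ⟨hqc, u, hu, hqr ▸ hru, hq⟩)
      obtain ⟨u', hu', h⟩ := hatt _ _ hql
      rcases h with h | h
      · exact .inr (.inl ⟨hqc, u', hu', h, hq⟩)
      · have := haug' hpr hql hpq hqr hu hu' hru h
        subst this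
        have := hvalid _ _ hpr.adj_sub
        have := hvalid _ _ hql.adj_sub
        have := hvalid _ _ h
        have := hvalid _ _ hru
        omega)
  have hsub : {p | c p = c v} ⊆ M.verts := by
    intro p hp
    have hp' : c p ≠ c x := fun h => hvalid _ _ hvx (hp.symm.trans h)
    rcases hall p with h | ⟨-, _, -, -, h⟩ | h
    · exact absurd h.2 hp'
    · exact h
    · exact absurd h.1 hp'
  obtain ⟨S, hS₁, hS₂, hvS⟩ := hv
  have e1 := hG _ _ hS₁ hS₂ hS hc
  have e2 := hS.two_mul_ncard_inter c (c v)
  have e3 := hS₁.two_mul_ncard_inter c (c v)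
  rw [Set.inter_eq_right.2 hsub] at e2
  have e4 : (S ∩ {p | c p = c v}).ncard < {p | c p = c v}.ncard :=
    Set.ncard_lt_ncard ⟨Set.inter_subset_right, fun h => hvS (h (a := v) rfl).1⟩
  omega

theorem equiCovered_isolate_of_isBipartite [Finite V] (hconn : G.Connected) (hG : G.EquiCovered)
    (he : ∀ a b, G.Adj a b → (G.removeEdge s(a, b)).EquiCovered) (hbip : G.IsBipartite) (v : V) :
    (G.isolate v).EquiCovered := by
  obtain ⟨c⟩ := hbip
  -- A maximal matching of `G - v` that is not maximal in `G` becomes so by adding an edge at `v`.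
  have hext : ∀ S, (G.isolate v).Matchable S → (G.isolate v).IsVertexCoverSet S →
      G.IsVertexCoverSet S ∨ ∃ w ∉ S, G.Adj v w ∧ G.Matchable (insert v (insert w S)) ∧
        G.IsVertexCoverSet (insert v (insert w S)) := by
    intro S hS hSc
    rw [matchable_isolate_iff] at hS
    by_contra! hcon
    obtain ⟨h1, h2⟩ := hcon
    have hT : ∀ w ∉ S, G.Adj v w → False := by
      intro w hw hvw
      refine h2 w hw hvw (hS.1.addEdge hvw hS.2 hw) fun p q hpq => ?_
      by_cases hp : p = v
      · exact .inl (.inl hp)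
      by_cases hq : q = v
      · exact .inr (.inl hq)
      exact (hSc p q ⟨hpq, hp, hq⟩).imp (fun h => .inr (.inr h)) (fun h => .inr (.inr h))
    refine h1 fun p q hpq => ?_
    by_contra! h
    by_cases hp : p = v
    · exact hT q h.2 (hp ▸ hpq)
    by_cases hq : q = v
    · exact hT p h.1 (hq ▸ hpq.symm)
    exact (hSc p q ⟨hpq, hp, hq⟩).elim h.1 h.2
  by_cases hv : v ∈ G.missable
  · have hcov : ∀ S, (G.isolate v).Matchable S → (G.isolate v).IsVertexCoverSet S →
        G.IsVertexCoverSet S := by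
      intro S hS hSc
      refine (hext S hS hSc).resolve_right ?_
      rintro ⟨w, hw, hvw, hm, hmc⟩
      rw [matchable_isolate_iff] at hS
      obtain ⟨S₀, h0, h0c, hv0⟩ := hv
      have hw0 : w ∈ S₀ := (h0c v w hvw).resolve_left hv0
      obtain ⟨y, hy, hwy⟩ := h0.exists_adj hw0
      have hyv : y ≠ v := fun h => hv0 (h ▸ hy)
      -- The unmatched `x` cannot see `v`, as both are missable, nor `w`, since `S` is maximal in G
      -- - v.
      obtain ⟨x, hxv, hxw, hxS, hx⟩ := hG.exists_adj_unmatched (he v w hvw) hvw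
        (.inr ⟨hwy, hyv⟩) hS.1 hS.2 hw hmc
      rcases hx with hx | hx
      · exact missable_independent_of_isBipartite hconn hG he c ⟨S₀, h0, h0c, hv0⟩
          ⟨_, hm, hmc, by simp [hxv, hxw, hxS]⟩ hx
      · exact (hSc w x ⟨hx, hvw.ne', hxv⟩).elim hw hxS
    intro S T hS hS' hT hT'
    exact hG _ _ (matchable_isolate_iff.1 hS).1 (hcov S hS hS') (matchable_isolate_iff.1 hT).1
      (hcov T hT hT')
  · intro S T hS hS' hT hT'
    have h1 := matchable_isolate_iff.1 hS
    have h2 := matchable_isolate_iff.1 hT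
    obtain ⟨w, hw, hvw, hm, hmc⟩ := (hext S hS hS').resolve_left fun h => hv ⟨S, h1.1, h, h1.2⟩
    obtain ⟨w', hw', hvw', hm', hmc'⟩ :=
      (hext T hT hT').resolve_left fun h => hv ⟨T, h2.1, h, h2.2⟩
    have := hG _ _ hm hmc hm' hmc'
    rw [h1.1.ncard_insert_pair hvw h1.2 hw, h2.1.ncard_insert_pair hvw' h2.2 hw'] at this
    omega

/-! ### Odd cliques and the main theorem -/

theorem equiCovered_of_odd_of_forall_three [Finite V] (hodd : Odd (Nat.card V))
    (h3 : ∀ p q r, p ≠ q → p ≠ r → q ≠ r → G.Adj p q ∨ G.Adj p r ∨ G.Adj q r) :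
    G.EquiCovered := by
  have key : ∀ S, G.Matchable S → G.IsVertexCoverSet S → Sᶜ.ncard = 1 := by
    intro S hS hSc
    have hadd := Set.ncard_add_ncard_compl S
    have hle : Sᶜ.ncard ≤ 2 := by
      by_contra! h
      obtain ⟨p, hp, q, hq, r, hr, hpq, hpr, hqr⟩ := (Set.two_lt_ncard (s := Sᶜ)).1 h
      rcases h3 p q r hpq hpr hqr with h | h | h
      · exact (hSc p q h).elim hp hq
      · exact (hSc p r h).elim hp hr
      · exact (hSc q r h).elim hq hr
    rw [← hadd] at hodd
    obtain ⟨k, hk⟩ := (Nat.odd_add'.1 hodd).2 hS.even_ncard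
    omega
  intro S T hS hS' hT hT'
  have h1 := Set.ncard_add_ncard_compl S
  have h2 := Set.ncard_add_ncard_compl T
  have := key S hS hS'
  have := key T hT hT'
  omega

theorem IsOddClique.equiCovered_isolate [Finite V] (hG : G.IsOddClique) (v : V) :
    (G.isolate v).EquiCovered := by
  obtain ⟨rfl, hodd⟩ := hG
  refine equiCovered_of_odd_of_forall_three hodd fun p q r hpq hpr hqr => ?_
  simp only [isolate, top_adj]
  grind

theorem IsOddClique.equiCovered_removeEdge [Finite V] (hG : G.IsOddClique) (a b : V) :
    (G.removeEdge s(a, b)).EquiCovered := by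
  obtain ⟨rfl, hodd⟩ := hG
  refine equiCovered_of_odd_of_forall_three hodd fun p q r hpq hpr hqr => ?_
  simp only [removeEdge_adj, top_adj, Sym2.eq_iff, ne_eq]
  grind

end SimpleGraph

theorem mainTheorem8 {V : Type*} [Finite V] (G : SimpleGraph V)
    (hconn : G.Connected) (hG : G.IsEquimatchable) :
    ((∀ v : V, (G.removeVertex v).IsEquimatchable) ∧
        (∀ e ∈ G.edgeSet, (G.removeEdge e).IsEquimatchable)) ↔
      (G.IsOddClique ∨ (G.IsBipartite ∧ G.IsESE)) := by
  have hG' := SimpleGraph.isEquimatchable_iff_equiCovered.1 hG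
  constructor
  · rintro ⟨hv, he⟩
    refine (SimpleGraph.isOddClique_or_isBipartite hconn hG'
      (fun v => SimpleGraph.removeVertex_isEquimatchable_iff.1 (hv v))
      (fun a b h => SimpleGraph.isEquimatchable_iff_equiCovered.1 (he s(a, b) h))).imp_right
      fun h => ⟨h, hG, he⟩
  · rintro (h | ⟨h, -, he⟩)
    · refine ⟨fun v => SimpleGraph.removeVertex_isEquimatchable_iff.2 (h.equiCovered_isolate v),
        fun e _ => SimpleGraph.isEquimatchable_iff_equiCovered.2 ?_⟩
      induction e with
      | _ a b => exact h.equiCovered_removeEdge a b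
    · exact ⟨fun v => SimpleGraph.removeVertex_isEquimatchable_iff.2
        (SimpleGraph.equiCovered_isolate_of_isBipartite hconn hG'
          (fun a b h => SimpleGraph.isEquimatchable_iff_equiCovered.1 (he s(a, b) h)) h v), he⟩
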